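/- Let $G$ be a countable monoid, $k$ an uncountable algebraically closed field, and $X,Y$ algebraic varieties over $k$, i.e. reduced $k$-schemes of finite type, with sets of $k$-points $A=X(k)$, $B=Y(k)$. For a set $C$, let $G$ act on $C^G$ by $(g\star x)(h)=x(hg)$. A *subshift* of $C^G$ is a $G$-invariant subset; it is *of finite type* if it equals $\{x\in C^G : (g\star x)|_D\in P \text{ for all } g\in G\}$ for some finite $D\subset G$ and some $P\subset C^D$. For $\Sigma\subset C^G$ and finite $E\subset G$ put $\Sigma_E=\{x|_E : x\in\Sigma\}$. For a subshift $\Sigma\subset C^G$ and a set $C'$, a map $\tau\colon\Sigma\to C'^G$ is a *cellular automaton* if there are a finite $M\subset G$ and a map $\mu\colon\Sigma_M\to C'$ with $\tau(x)(g)=\mu((g\star x)|_M)$ for all $x\in\Sigma$, $g\in G$. A subshift is *sofic* if it is the image of a subshift of finite type (over some alphabet) under a cellular automaton. A subshift $\Sigma\subset A^G$ is *algebraic* if for every finite $E\subset G$ the set $\Sigma_E$ is a (locally closed) subvariety of $A^E=X^E(k)$. A map $\tau\colon\Sigma\to B^G$ on an algebraic subshift $\Sigma$ is an *algebraic cellular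 automaton* if it is a cellular automaton for some finite $M$ and $\mu$ as above such that $\mu\colon\Sigma_M\to B$ is a morphism of algebraic varieties over $k$. Let $\Sigma\subset A^G$ be an algebraic subshift that is closed in the prodiscrete topology (the product of the discrete topologies on $A$), and let $\tau\colon\Sigma\to B^G$ be an injective algebraic cellular automaton. Then for every subshift $\Delta\subset A^G$ with $\Delta\subset\Sigma$: (i) $\Delta$ is a subshift of finite type (of $A^G$) if and only if $\tau(\Delta)$ is a subshift of finite type (of $B^G$); (ii) $\Delta$ is sofic if and only if $\tau(\Delta)$ is sofic. -/

import Mathlib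

open CategoryTheory CategoryTheory.Limits AlgebraicGeometry

universe u v w

/-! ### Symbolic dynamics over a monoid -/

namespace SymbolicVariety

section Dynamics

variable {G : Type v} [Monoid G] {A : Type u} {B : Type w}

/-- The shift action of `G` on configurations: `(g ⋆ x)(h) = x (h * g)`. -/
def shift (g : G) (x : G → A) : G → A := fun h => x (h * g)

/-- A subshift of `A^G` is a `G`-invariant subset (closedness is not part of the definition). -/
def IsSubshift (S : Set (G → A)) : Prop := ∀ g : G, ∀ x ∈ S, shift g x ∈ S

/-- Closedness for the prodiscrete topology on `A^G`: the product of discrete topologies. -/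
def IsProdiscreteClosed (S : Set (G → A)) : Prop :=
  @IsClosed (G → A) (@Pi.topologicalSpace G (fun _ => A) (fun _ => ⊥)) S

/-- The restriction `S_E = {x|_E : x ∈ S}` of `S ⊆ A^G` to a finite set `E ⊆ G`. -/
def restrictSet (S : Set (G → A)) (E : Finset G) : Set (E → A) :=
  (fun x : G → A => E.restrict x) '' S

/-- The subshift `Σ(A^G; D, P)` with defining window `D` and set of admissible patterns `P`. -/
def sft (D : Finset G) (P : Set (D → A)) : Set (G → A) :=
  {x | ∀ g : G, D.restrict (shift g x) ∈ P}

/-- Subshifts of finite type. -/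
def IsSFT (S : Set (G → A)) : Prop := ∃ (D : Finset G) (P : Set (D → A)), S = sft D P

theorem shift_restrict_mem {S : Set (G → A)} (hS : IsSubshift S) (E : Finset G) (c : S) (g : G) :
    E.restrict (shift g c.1) ∈ restrictSet S E :=
  ⟨shift g c.1, hS g c.1 c.2, rfl⟩

/-- `μ : S_M → B` is a local defining map of `τ : S → B^G` for the memory set `M`. -/
def IsLocalDefiningMap {S : Set (G → A)} (hS : IsSubshift S) (τ : S → G → B)
    (M : Finset G) (μ : restrictSet S M → B) : Prop :=
  ∀ (c : S) (g : G), τ c g = μ ⟨M.restrict (shift g c.1), shift_restrict_mem hS M c g⟩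

/-- Cellular automata `τ : S → B^G` on a subshift `S ⊆ A^G`. -/
def IsCellularAutomaton {S : Set (G → A)} (hS : IsSubshift S) (τ : S → G → B) : Prop :=
  ∃ (M : Finset G) (μ : restrictSet S M → B), IsLocalDefiningMap hS τ M μ

/-- Sofic subshifts: images of subshifts of finite type, over an arbitrary alphabet `C`, under
cellular automata. (For countable `G`, alphabets in larger universes give nothing more: only the
letters occurring in one chosen preimage of each configuration of `S` are needed.) -/
def IsSofic (S : Set (G → A)) : Prop :=
  ∃ (C : Type u) (W : Set (G → C)) (hW : IsSubshift W) (γ : W → G → A),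
    IsSFT W ∧ IsCellularAutomaton hW γ ∧ Set.range γ = S

end Dynamics

/-! ### Algebraic varieties and their `k`-points -/

section Varieties

variable {k : Type u} [Field k]

/-- A variety over `k`: a reduced `k`-scheme of finite type. -/
class IsVariety (X : Over (Spec (.of k))) : Prop where
  reduced : IsReduced X.left
  locallyOfFiniteType : LocallyOfFiniteType X.hom
  quasiCompact : QuasiCompact X.hom

/-- The set `X(k)` of `k`-points of a `k`-scheme: the `k`-morphisms `Spec k ⟶ X`. -/
abbrev KPoints (X : Over (Spec (.of k))) : Type u := Over.mk (𝟙 (Spec (.of k))) ⟶ X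

/-- The fibre power `X^E` over `k`, for a finite index set `E`. -/
noncomputable abbrev power (X : Over (Spec (.of k))) (E : Type v) [Finite E] :
    Over (Spec (.of k)) := ∏ᶜ fun _ : E => X

/-- The identification `X^E(k) = X(k)^E`. -/
noncomputable def coords {X : Over (Spec (.of k))} {E : Type v} [Finite E]
    (p : KPoints (power X E)) : E → KPoints X := fun e => p ≫ Pi.π (fun _ : E => X) e

/-- The morphism `i : V ⟶ X^E` exhibits the set `S ⊆ X(k)^E` as (the set of `k`-points of) a
subvariety of `X^E`: `V` is reduced, `i` is an immersion, i.e. an isomorphism onto a locally closed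
subscheme, and `S` is the set of `k`-points of `V`. -/
structure Presents {X : Over (Spec (.of k))} {E : Type v} [Finite E] (S : Set (E → KPoints X))
    {V : Over (Spec (.of k))} (i : V ⟶ power X E) : Prop where
  reduced : IsReduced V.left
  immersion : IsImmersion i.left
  range_eq : Set.range (fun p : KPoints V => coords (p ≫ i)) = S

/-- `S ⊆ X(k)^E` is a (locally closed) subvariety. -/
def IsSubvariety {X : Over (Spec (.of k))} {E : Type v} [Finite E]
    (S : Set (E → KPoints X)) : Prop :=
  ∃ (V : Over (Spec (.of k))) (i : V ⟶ power X E), Presents S i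

/-- `μ : S → Y(k)` is a morphism of varieties, where `S ⊆ X(k)^E` is a subvariety: it is induced
on `k`-points by a morphism `f` of `k`-schemes. -/
def IsAlgebraicMap {X Y : Over (Spec (.of k))} {E : Type v} [Finite E]
    (S : Set (E → KPoints X)) (μ : S → KPoints Y) : Prop :=
  ∃ (V : Over (Spec (.of k))) (i : V ⟶ power X E) (f : V ⟶ Y), Presents S i ∧
    ∀ (p : KPoints V) (s : S), coords (p ≫ i) = s.1 → μ s = p ≫ f

variable {G : Type v} [Monoid G]

/-- Algebraic subshifts `S ⊆ X(k)^G`. -/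
def IsAlgebraicSubshift {X : Over (Spec (.of k))} (S : Set (G → KPoints X)) : Prop :=
  IsSubshift S ∧ ∀ E : Finset G, IsSubvariety (restrictSet S E)

/-- Algebraic cellular automata `τ : S → Y(k)^G` on an algebraic subshift `S ⊆ X(k)^G`. -/
def IsAlgebraicCA {X Y : Over (Spec (.of k))} {S : Set (G → KPoints X)}
    (hS : IsAlgebraicSubshift S) (τ : S → G → KPoints Y) : Prop :=
  ∃ (M : Finset G) (μ : restrictSet S M → KPoints Y),
    IsAlgebraicMap (restrictSet S M) μ ∧ IsLocalDefiningMap hS.1 τ M μ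

end Varieties

end SymbolicVariety

/-!
An injective algebraic cellular automaton `τ : S → Y(k)^G` on a prodiscretely closed algebraic
subshift is reversible: there is a finite set `N ⊆ G` such that the letters of `τ x` on `N`
determine the letter of `x` at the identity (`exists_memory_of_injective`). The statement on
subshifts of finite type and sofic subshifts then follows formally (`isSFT_and_isSofic_image_iff`):
`τ` and its inverse extend to cellular automata `F`, `H` between the full shifts, and `F '' Δ`
consists of the `y` with `H y ∈ Δ` and `F (H y) = y`, which is a condition of finite type if `Δ` is
of finite type. No finiteness condition on `S` itself is needed.

Reversibility is a compactness argument. If it fails, then for every finite `N` there are `x, y ∈ S`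
with `x 1 ≠ y 1` whose images agree on `N`. That `x` and `y` lie in `S` (which is closed), that they
have the same image and that they differ at `1` is a countable family of equations and inequations
`f p = g q` between `k`-points of schemes of finite type, and any finite part of it is satisfiable.
Over an uncountable algebraically closed field the whole family is then satisfiable
(`exists_points_forall_holds_iff`), and `τ` is not injective.

This saturation property is proved by ultraproducts. An ultrafilter along which all relations hold
selects an affine chart for every unknown, so that the unknowns become homomorphisms from
`k`-algebras of finite type to the ring of germs of functions `Ω → k`. Only countably many functions
are needed to generate the images of all charts, together with one inverse for each inequation.
The algebra which they generate has a `k`-point (`exists_specialization`) by the Nullstellensatz for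
countably many generators (`exists_algHom_of_countable_adjoin_eq_top`), and composing with it gives
the required solution.
-/

namespace SymbolicVariety

/-! ### Subshifts and cellular automata -/

section Dynamics

variable {G : Type v} [Monoid G] {A : Type*} {B : Type*}

/-- The cellular automaton `A^G → B^G` on the full shift with memory set `M` and local rule `μ`. -/
def fullCA (M : Finset G) (μ : (M → A) → B) (x : G → A) : G → B :=
  fun g => μ (M.restrict (shift g x))

theorem shift_shift (g h : G) (x : G → A) : shift g (shift h x) = shift (g * h) x := by
  funext t
  simp [shift, mul_assoc]

theorem shift_fullCA (M : Finset G) (μ : (M → A) → B) (g : G) (x : G → A) :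
    shift g (fullCA M μ x) = fullCA M μ (shift g x) := by
  funext h
  simp only [fullCA, shift_shift]
  rfl

/-- The pattern on `N` of a full cellular automaton with memory set `M` is determined by the
pattern of the argument on any window containing the products `m * n`. -/
theorem exists_restrict_fullCA {M N E : Finset G} (μ : (M → A) → B)
    (hE : ∀ m ∈ M, ∀ n ∈ N, m * n ∈ E) :
    ∃ ρ : (E → A) → (N → B), ∀ x : G → A, N.restrict (fullCA M μ x) = ρ (E.restrict x) :=
  ⟨fun z n => μ fun m => z ⟨m.1 * n.1, hE _ m.2 _ n.2⟩, fun _ => rfl⟩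

/-- A full cellular automaton `F` maps a subshift of finite type `W` on which it has a left
inverse `H`, again a full cellular automaton, onto a subshift of finite type: the image consists of
the `y` with `H y ∈ W` and `F (H y) = y`, and both are local conditions. -/
theorem IsSFT.image_fullCA {W : Set (G → A)} (hW : IsSFT W) (M N : Finset G)
    (μ : (M → A) → B) (ν : (N → B) → A)
    (hinv : ∀ x ∈ W, fullCA N ν (fullCA M μ x) = x) :
    IsSFT (fullCA M μ '' W) := by
  classical
  obtain ⟨D, P, rfl⟩ := hW
  let E : Finset G := insert 1 ((N ×ˢ (D ∪ M)).image fun p => p.1 * p.2)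
  have h1 : (1 : G) ∈ E := Finset.mem_insert_self _ _
  have hE : ∀ n ∈ N, ∀ d ∈ D ∪ M, n * d ∈ E := fun n hn d hd => Finset.mem_insert_of_mem
    (Finset.mem_image.2 ⟨(n, d), Finset.mem_product.2 ⟨hn, hd⟩, rfl⟩)
  obtain ⟨ρ₁, h₁⟩ := exists_restrict_fullCA ν
    fun n hn d hd => hE n hn d (Finset.mem_union_left M hd)
  obtain ⟨ρ₂, h₂⟩ := exists_restrict_fullCA ν
    fun n hn m hm => hE n hn m (Finset.mem_union_right D hm)
  refine ⟨E, {z | ρ₁ z ∈ P ∧ μ (ρ₂ z) = z ⟨1, h1⟩}, ?_⟩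
  have key : ∀ (y : G → B) (g : G),
      E.restrict (shift g y) ∈ {z : E → B | ρ₁ z ∈ P ∧ μ (ρ₂ z) = z ⟨1, h1⟩} ↔
        D.restrict (shift g (fullCA N ν y)) ∈ P ∧ fullCA M μ (fullCA N ν y) g = y g := by
    intro y g
    have hy : (E.restrict (shift g y)) ⟨1, h1⟩ = y g := by simp [shift]
    rw [Set.mem_ofPred_eq, ← h₁, ← h₂, hy, fullCA, shift_fullCA]
  ext y
  constructor
  · rintro ⟨x, hx, rfl⟩ g
    rw [key, hinv x hx]
    exact ⟨hx g, rfl⟩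
  · intro hy
    exact ⟨fullCA N ν y, fun g => ((key y g).1 (hy g)).1,
      funext fun g => ((key y g).1 (hy g)).2⟩

/-- The image of a sofic subshift under a full cellular automaton is sofic. -/
theorem IsSofic.image_fullCA {A B : Type u} {W : Set (G → A)} (hW : IsSofic W) (M : Finset G)
    (μ : (M → A) → B) : IsSofic (fullCA M μ '' W) := by
  classical
  obtain ⟨C, V, hV, γ, hV', ⟨N, ν, hν⟩, rfl⟩ := hW
  refine ⟨C, V, hV, fun c => fullCA M μ (γ c), hV', ?_, ?_⟩
  · set E := (N ×ˢ M).image (fun p => p.1 * p.2) with hE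
    have hsub : ∀ m : M, ∀ n : N, n.1 * m.1 ∈ E := fun m n =>
      Finset.mem_image.2 ⟨(n.1, m.1), Finset.mem_product.2 ⟨n.2, m.2⟩, rfl⟩
    have hmem : ∀ (z : restrictSet V E) (m : M),
        (fun n : N => z.1 ⟨n.1 * m.1, hsub m n⟩) ∈ restrictSet V N := by
      rintro ⟨_, x, hx, rfl⟩ m
      exact ⟨shift m.1 x, hV _ _ hx, rfl⟩
    refine ⟨E, fun z => μ fun m => ν ⟨_, hmem z m⟩, fun c g => ?_⟩
    simp only [fullCA]
    congr 1
    funext m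
    have := hν c (m.1 * g)
    simp only [Finset.restrict, shift] at this ⊢
    rw [this]
    congr 2
    funext n
    exact congrArg c.1 (mul_assoc n.1 m.1 g).symm
  · ext y
    simp

theorem isSFT_empty : IsSFT (∅ : Set (G → A)) :=
  ⟨∅, ∅, by ext x; simp [sft]⟩

theorem isSofic_empty {A : Type u} : IsSofic (∅ : Set (G → A)) :=
  ⟨A, ∅, fun _ _ h => h.elim, fun c => c.1, isSFT_empty,
    ⟨∅, fun z => z.2.choose_spec.1.elim, fun c => c.2.elim⟩, by simp⟩

/-- Membership in a prodiscretely closed set can be tested on finite windows. -/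
theorem IsProdiscreteClosed.mem_of_forall_restrict {G A : Type*} {S : Set (G → A)} (hS : IsProdiscreteClosed S)
    {x : G → A} (hx : ∀ E : Finset G, E.restrict x ∈ restrictSet S E) : x ∈ S := by
  classical
  let : TopologicalSpace A := ⊥
  have : DiscreteTopology A := ⟨rfl⟩
  have hS' : IsClosed S := hS
  rw [← hS'.closure_eq, mem_closure_iff]
  intro o ho hxo
  obtain ⟨I, w, hw, hsub⟩ := isOpen_pi_iff.1 ho x hxo
  obtain ⟨y, hy, hyx⟩ := hx I
  refine ⟨y, hsub fun i hi => ?_, hy⟩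
  have : y i = x i := congrFun hyx ⟨i, hi⟩
  rw [this]
  exact (hw i hi).2

/-- Suppose that `τ` is given on `S` by a local rule with memory set `M` and
that finitely many letters of `τ x` determine the letter of `x` at the identity. Then `τ`
preserves and reflects being of finite type, and being sofic. -/
theorem isSFT_and_isSofic_image_iff {A B : Type u} {S : Set (G → A)} (hS : IsSubshift S)
    {τ : S → G → B} {M : Finset G} {μ : restrictSet S M → B}
    (hμ : IsLocalDefiningMap hS τ M μ) {N : Finset G}
    (hN : ∀ x y : S, (∀ n ∈ N, τ x n = τ y n) → x.1 1 = y.1 1)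
    {Δ : Set (G → A)} (hΔS : Δ ⊆ S) :
    (IsSFT Δ ↔ IsSFT (τ '' {x : S | x.1 ∈ Δ})) ∧
      (IsSofic Δ ↔ IsSofic (τ '' {x : S | x.1 ∈ Δ})) := by
  classical
  rcases S.eq_empty_or_nonempty with rfl | ⟨x₀, hx₀⟩
  · have hΔ : Δ = ∅ := Set.subset_empty_iff.1 hΔS
    subst hΔ
    have h0 : τ '' {x | x.1 ∈ (∅ : Set (G → A))} = ∅ := by simp
    simp only [h0, isSFT_empty, isSofic_empty, and_self]
  have : Nonempty A := ⟨x₀ 1⟩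
  have : Nonempty B := ⟨τ ⟨x₀, hx₀⟩ 1⟩
  let μ' : (M → A) → B := fun z =>
    if h : z ∈ restrictSet S M then μ ⟨z, h⟩ else Classical.arbitrary B
  have hF : ∀ x : S, fullCA M μ' x.1 = τ x := by
    intro x
    funext g
    simp only [fullCA, μ']
    rw [dif_pos (shift_restrict_mem hS M x g), hμ x g]
  let ν : (N → B) → A := fun z =>
    if h : ∃ x : S, N.restrict (τ x) = z then h.choose.1 1 else Classical.arbitrary A
  have hν : ∀ x : S, ν (N.restrict (τ x)) = x.1 1 := by
    intro x
    have h : ∃ y : S, N.restrict (τ y) = N.restrict (τ x) := ⟨x, rfl⟩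
    simp only [ν]
    rw [dif_pos h]
    exact hN _ _ fun n hn => congrFun h.choose_spec ⟨n, hn⟩
  have hH : ∀ x ∈ S, fullCA N ν (fullCA M μ' x) = x := by
    intro x hx
    funext g
    have := hν ⟨shift g x, hS g x hx⟩
    rw [← hF] at this
    simp only [fullCA, shift_fullCA] at this ⊢
    simpa [shift] using this
  have himage : τ '' {x : S | x.1 ∈ Δ} = fullCA M μ' '' Δ := by
    ext y
    constructor
    · rintro ⟨x, hx, rfl⟩
      exact ⟨x.1, hx, hF x⟩
    · rintro ⟨x, hx, rfl⟩
      exact ⟨⟨x, hΔS hx⟩, hx, (hF _).symm⟩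
  have hback : fullCA N ν '' (fullCA M μ' '' Δ) = Δ := by
    rw [Set.image_image]
    refine Eq.trans (Set.image_congr fun x hx => hH x (hΔS hx)) (Set.image_id' _)
  rw [himage]
  refine ⟨⟨fun h => h.image_fullCA M N μ' ν fun x hx => hH x (hΔS hx), fun h => ?_⟩,
    ⟨fun h => h.image_fullCA M μ', fun h => ?_⟩⟩
  · rw [← hback]
    refine h.image_fullCA N M ν μ' ?_
    rintro _ ⟨x, hx, rfl⟩
    rw [hH x (hΔS hx)]
  · rw [← hback]
    exact h.image_fullCA N ν

end Dynamics

/-! ### Countably generated algebras -/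

section Algebra

/-- Nullstellensatz for countably many generators: over an uncountable algebraically closed field
`k`, every proper ideal of a countably generated algebra has a zero over `k`. A residue field has
countable dimension, while a transcendental element `x` would give the uncountable linearly
independent family `(x - a)⁻¹`, `a ∈ k`. -/
theorem exists_algHom_of_countable_adjoin_eq_top {k R : Type*} [Field k] [IsAlgClosed k]
    [Uncountable k] [CommRing R] [Algebra k R] {s : Set R} (hs : s.Countable)
    (hs' : Algebra.adjoin k s = ⊤) {I : Ideal R} (hI : I ≠ ⊤) :
    ∃ φ : R →ₐ[k] k, ∀ x ∈ I, φ x = 0 := by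
  obtain ⟨m, hm, hIm⟩ := Ideal.exists_le_maximal I hI
  let : Field (R ⧸ m) := Ideal.Quotient.field m
  have hspan : Submodule.span k ((Submonoid.closure s : Submonoid R) : Set R) = ⊤ := by
    rw [← Algebra.adjoin_eq_span, hs']; rfl
  have hcount : ((Submonoid.closure s : Submonoid R) : Set R).Countable := by
    have : Countable s := hs.to_subtype
    have : Countable (FreeMonoid s) := inferInstanceAs (Countable (List s))
    rw [Submonoid.closure_eq_mrange, MonoidHom.coe_mrange]
    exact Set.countable_range _
  have hrank : Module.rank k (R ⧸ m) ≤ Cardinal.aleph0 := by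
    refine (LinearMap.rank_le_of_surjective (Ideal.Quotient.mkₐ k m).toLinearMap
      (Ideal.Quotient.mkₐ_surjective k m)).trans ?_
    rw [← rank_top, ← hspan]
    exact (rank_span_le _).trans (Cardinal.le_aleph0_iff_set_countable.2 hcount)
  have hint : Algebra.IsAlgebraic k (R ⧸ m) := by
    refine ⟨fun x => ?_⟩
    by_contra hx
    have h := (show Transcendental k x from hx).linearIndependent_sub_inv.cardinal_lift_le_rank
    have h2 : Cardinal.lift (Cardinal.mk k) ≤ Cardinal.aleph0 :=
      h.trans (Cardinal.lift_le_aleph0.2 hrank)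
    rw [Cardinal.lift_le_aleph0, Cardinal.mk_le_aleph0_iff] at h2
    exact not_countable h2
  have hbij := IsAlgClosed.algebraMap_bijective_of_isIntegral (k := k) (K := R ⧸ m)
  let e : (R ⧸ m) →ₐ[k] k :=
    ((AlgEquiv.ofBijective (Algebra.ofId k (R ⧸ m)) hbij).symm : (R ⧸ m) →ₐ[k] k)
  refine ⟨e.comp (Ideal.Quotient.mkₐ k m), fun x hx => ?_⟩
  rw [AlgHom.comp_apply, Ideal.Quotient.mkₐ_eq_mk, Ideal.Quotient.eq_zero_iff_mem.2 (hIm hx),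
    map_zero]

end Algebra

/-! ### Specialization of families of `k`-valued functions -/

section Specialization

variable {Ω : Type*} {k : Type*} [Field k]

/-- A `k`-point of (a subalgebra of) the ring of germs of functions `Ω → k` along `l`: a subalgebra
`ring` of `Ω → k`, together with a `k`-algebra homomorphism to `k` whose value on a function depends
only on the germ of this function. -/
structure Specialization (k : Type*) [Field k] (l : Filter Ω) where
  /-- The subalgebra of functions that can be specialized. -/
  ring : Subalgebra k (Ω → k)
  /-- The value of a function under the specialization. -/
  hom : ring →ₐ[k] k
  /-- The value depends only on the germ of the function. -/
  hom_congr : ∀ f g : ring, f.1 =ᶠ[l] g.1 → hom f = hom g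

/-- Countably many functions can be specialized. -/
theorem exists_specialization [IsAlgClosed k] [Uncountable k] (l : Filter Ω) [l.NeBot]
    {T : Set (Ω → k)} (hT : T.Countable) : ∃ s : Specialization k l, T ⊆ s.ring := by
  let R := Algebra.adjoin k T
  let I : Ideal R :=
    { carrier := {f | f.1 =ᶠ[l] 0}
      add_mem' := fun {a b} ha hb => by simpa using Filter.EventuallyEq.add ha hb
      zero_mem' := Filter.EventuallyEq.rfl
      smul_mem' := fun c x hx => by
        simpa using (Filter.EventuallyEq.refl l c.1).mul (show x.1 =ᶠ[l] 0 from hx) }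
  have hI : I ≠ ⊤ := fun h => by
    have h1 : ((1 : R) : Ω → k) =ᶠ[l] 0 := (I.eq_top_iff_one.1 h : (1 : R) ∈ I)
    obtain ⟨ω, hω⟩ := h1.exists
    exact one_ne_zero hω
  obtain ⟨φ, hφ⟩ := exists_algHom_of_countable_adjoin_eq_top
    (hT.preimage Subtype.val_injective) (Algebra.adjoin_adjoin_coe_preimage (R := k) (s := T)) hI
  refine ⟨⟨R, φ, fun f g hfg => ?_⟩, Algebra.subset_adjoin⟩
  rw [← sub_eq_zero, ← map_sub]
  refine hφ _ ?_
  change (f.1 - g.1) =ᶠ[l] 0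
  simpa using Filter.EventuallyEq.sub hfg (Filter.EventuallyEq.refl l g.1)

variable {A B : Type*} [CommRing A] [Algebra k A] [CommRing B] [Algebra k B] {l : Filter Ω}

/-- The element `a` of `A`, as a function on a family of `k`-points of `A`. -/
def evalFun (ψ : Ω → A →ₐ[k] k) : A →ₐ[k] (Ω → k) := AlgHom.pi ψ

/-- The specialization of a family of `k`-points of `A`. -/
def Specialization.map (s : Specialization k l) (ψ : Ω → A →ₐ[k] k)
    (h : ∀ a, evalFun ψ a ∈ s.ring) : A →ₐ[k] k :=
  s.hom.comp ((evalFun ψ).codRestrict s.ring h)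

theorem Specialization.map_apply (s : Specialization k l) (ψ : Ω → A →ₐ[k] k)
    (h : ∀ a, evalFun ψ a ∈ s.ring) (a : A) : s.map ψ h a = s.hom ⟨evalFun ψ a, h a⟩ := rfl

theorem Specialization.map_comp_eq (s : Specialization k l) {ψ : Ω → A →ₐ[k] k}
    {χ : Ω → B →ₐ[k] k} (hψ : ∀ a, evalFun ψ a ∈ s.ring) (hχ : ∀ a, evalFun χ a ∈ s.ring)
    {E : Type*} [CommRing E] [Algebra k E] (f : E →ₐ[k] A) (g : E →ₐ[k] B)
    (h : ∀ᶠ ω in l, (ψ ω).comp f = (χ ω).comp g) :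
    (s.map ψ hψ).comp f = (s.map χ hχ).comp g := by
  ext e
  exact s.hom_congr _ _ (h.mono fun ω hω => DFunLike.congr_fun hω e)

theorem Specialization.hom_ne_zero (s : Specialization k l) (f : s.ring)
    (hf : ∀ᶠ ω in l, f.1 ω ≠ 0) (hinv : f.1⁻¹ ∈ s.ring) : s.hom f ≠ 0 := by
  have h : s.hom (f * ⟨f.1⁻¹, hinv⟩) = s.hom 1 :=
    s.hom_congr _ _ (hf.mono fun ω hω => mul_inv_cancel₀ hω)
  rw [map_mul, map_one] at h
  exact left_ne_zero_of_mul_eq_one h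

/-- The family of points of an algebra of finite type can be specialized as soon as certain finitely
many functions can. -/
theorem exists_finite_forall_evalFun_mem [Algebra.FiniteType k A] (ψ : Ω → A →ₐ[k] k) :
    ∃ T : Set (Ω → k), T.Finite ∧
      ∀ R : Subalgebra k (Ω → k), T ⊆ R → ∀ a, evalFun ψ a ∈ R := by
  obtain ⟨t, ht⟩ := (Algebra.FiniteType.out : (⊤ : Subalgebra k A).FG)
  refine ⟨evalFun ψ '' t, t.finite_toSet.image _, fun R hR a => ?_⟩
  have h : (⊤ : Subalgebra k A) ≤ R.comap (evalFun ψ) := by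
    rw [← ht, Algebra.adjoin_le_iff]
    exact fun b hb => hR ⟨b, hb, rfl⟩
  exact h (Algebra.mem_top (x := a))

end Specialization

/-! ### Affine schemes over `k` and their `k`-points -/

section Affine

variable {k : Type u} [Field k] {A B C : Type u} [CommRing A] [Algebra k A] [CommRing B]
  [Algebra k B] [CommRing C] [Algebra k C]

variable (k A) in
/-- The spectrum of a `k`-algebra, as a scheme over `k`. -/
noncomputable def specOver : Over (Spec (.of k)) :=
  Over.mk (Spec.map (CommRingCat.ofHom (algebraMap k A)))

/-- The morphism of spectra induced by a homomorphism of `k`-algebras. -/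
noncomputable def specOverMap (f : A →ₐ[k] B) : specOver k B ⟶ specOver k A :=
  Over.homMk (Spec.map (CommRingCat.ofHom f.toRingHom)) (by
    simp only [specOver, Over.mk_hom, ← Spec.map_comp, ← CommRingCat.ofHom_comp]
    congr 2
    exact f.comp_algebraMap)

/-- The `k`-point of the spectrum of `A` given by a homomorphism `A →ₐ[k] k`. -/
noncomputable def pointOf (ψ : A →ₐ[k] k) : KPoints (specOver k A) :=
  Over.homMk (Spec.map (CommRingCat.ofHom ψ.toRingHom)) (by
    simp only [specOver, Over.mk_hom, ← Spec.map_comp, ← CommRingCat.ofHom_comp]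
    rw [← Spec.map_id]
    congr 2
    exact ψ.comp_algebraMap)

theorem pointOf_comp (ψ : B →ₐ[k] k) (f : A →ₐ[k] B) :
    pointOf (ψ.comp f) = pointOf ψ ≫ specOverMap f := by
  ext1
  change Spec.map (CommRingCat.ofHom (ψ.comp f).toRingHom) =
    Spec.map (CommRingCat.ofHom ψ.toRingHom) ≫ Spec.map (CommRingCat.ofHom f.toRingHom)
  rw [← Spec.map_comp]
  rfl

theorem pointOf_injective : Function.Injective (pointOf : (A →ₐ[k] k) → _) := by
  intro ψ χ h
  have h1 := Spec.map_injective (congrArg Over.Hom.left h)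
  ext a
  exact congrArg (fun q : CommRingCat.of A ⟶ CommRingCat.of k => q.hom a) h1

theorem exists_specOverMap_eq (m : specOver k B ⟶ specOver k A) :
    ∃ f : A →ₐ[k] B, specOverMap f = m := by
  obtain ⟨r, hr⟩ := Spec.map_surjective m.left
  have h : CommRingCat.ofHom (algebraMap k A) ≫ r = CommRingCat.ofHom (algebraMap k B) := by
    apply Spec.map_injective
    rw [Spec.map_comp, hr]
    exact Over.w m
  refine ⟨⟨r.hom, fun x => ?_⟩, ?_⟩
  · exact congrArg (fun q : CommRingCat.of k ⟶ CommRingCat.of B => q.hom x) h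
  · ext1
    exact hr

theorem exists_pointOf_eq (p : KPoints (specOver k A)) : ∃ ψ : A →ₐ[k] k, pointOf ψ = p := by
  obtain ⟨r, hr⟩ := Spec.map_surjective p.left
  have h : CommRingCat.ofHom (algebraMap k A) ≫ r = 𝟙 _ := by
    apply Spec.map_injective
    rw [Spec.map_comp, hr, Spec.map_id]
    exact Over.w p
  refine ⟨⟨r.hom, fun x => ?_⟩, ?_⟩
  · exact congrArg (fun q : CommRingCat.of k ⟶ CommRingCat.of k => q.hom x) h
  · ext1
    exact hr

variable {X Z : Over (Spec (.of k))}

/-- The topological point underlying a `k`-point. -/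
noncomputable def pt (p : KPoints X) : X.left := p.left (IsLocalRing.closedPoint k)

theorem pt_comp (p : KPoints X) (f : X ⟶ Z) : pt (p ≫ f) = f.left (pt p) := by
  exact Scheme.Hom.comp_apply p.left f.left _

theorem range_left_eq (p : KPoints X) : Set.range p.left = {pt p} := by
  ext x
  constructor
  · rintro ⟨y, rfl⟩
    have : y = IsLocalRing.closedPoint k :=
      Subsingleton.elim (α := PrimeSpectrum k) _ _
    rw [this]; rfl
  · rintro rfl
    exact ⟨_, rfl⟩

theorem pt_pointOf_mem_basicOpen (ψ : A →ₐ[k] k) (a : A) :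
    pt (pointOf ψ) ∈ (PrimeSpectrum.basicOpen a : Set (PrimeSpectrum A)) ↔ ψ a ≠ 0 := by
  change ¬ (ψ a ∈ IsLocalRing.maximalIdeal k) ↔ _
  simp

/-- A morphism into `X` factors through an open subscheme if it does so set-theoretically. -/
theorem exists_lift {U : Over (Spec (.of k))} (j : U ⟶ X) [IsOpenImmersion j.left] (f : Z ⟶ X)
    (h : Set.range f.left ⊆ Set.range j.left) : ∃ m : Z ⟶ U, m ≫ j = f := by
  refine ⟨Over.homMk (IsOpenImmersion.lift j.left f.left h) ?_, ?_⟩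
  · rw [← Over.w j, IsOpenImmersion.lift_fac_assoc, Over.w f]
  · ext1
    exact IsOpenImmersion.lift_fac _ _ _

theorem exists_lift_point {U : Over (Spec (.of k))} (j : U ⟶ X) [IsOpenImmersion j.left]
    (p : KPoints X) (h : pt p ∈ Set.range j.left) : ∃ q : KPoints U, q ≫ j = p :=
  exists_lift j p (by rw [range_left_eq]; simpa using h)

end Affine

/-! ### Affine charts along an ultrafilter -/

section Charts

variable {k : Type u} [Field k]

/-- If finitely many affine charts cover `X`, one of them contains almost all members of a family
of `k`-points. -/
theorem exists_chart {X : Over (Spec (.of k))} [LocallyOfFiniteType X.hom] [CompactSpace X.left]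
    {Ω : Type*} (U : Ultrafilter Ω) (z : Ω → KPoints X) :
    ∃ (C : Type u) (_ : CommRing C) (_ : Algebra k C) (_ : Algebra.FiniteType k C)
      (j : specOver k C ⟶ X) (_ : IsOpenImmersion j.left) (ψ : Ω → C →ₐ[k] k),
      ∀ᶠ ω in U, z ω = pointOf (ψ ω) ≫ j := by
  let 𝒱 := X.left.affineOpenCover
  obtain ⟨t, ht⟩ := isCompact_univ.elim_finite_subcover (fun i => Set.range (𝒱.f i))
    (fun i => (𝒱.f i).isOpenEmbedding.isOpen_range)
    (fun x _ => Set.mem_iUnion.2 ⟨_, 𝒱.covers x⟩)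
  have hU : (⋃ i ∈ (t : Set 𝒱.I₀), {ω | pt (z ω) ∈ Set.range (𝒱.f i)}) ∈ U :=
    Filter.univ_mem' fun ω => by simpa using ht (Set.mem_univ (pt (z ω)))
  obtain ⟨i, -, hi⟩ := (Ultrafilter.finite_biUnion_mem_iff t.finite_toSet).1 hU
  let r : CommRingCat.of k ⟶ 𝒱.X i := Spec.preimage (𝒱.f i ≫ X.hom)
  let : Algebra k (𝒱.X i) := r.hom.toAlgebra
  have hr : Spec.map (CommRingCat.ofHom (algebraMap k (𝒱.X i))) = 𝒱.f i ≫ X.hom :=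
    Spec.map_preimage _
  have hft : LocallyOfFiniteType (Spec.map (CommRingCat.ofHom (algebraMap k (𝒱.X i)))) := by
    rw [hr]; infer_instance
  let j : specOver k (𝒱.X i) ⟶ X := Over.homMk (𝒱.f i) hr.symm
  have hj : IsOpenImmersion j.left := inferInstanceAs (IsOpenImmersion (𝒱.f i))
  have hlift : ∀ ω, pt (z ω) ∈ Set.range (𝒱.f i) →
      ∃ ψ : 𝒱.X i →ₐ[k] k, z ω = pointOf ψ ≫ j := fun ω hω => by
    obtain ⟨q, hq⟩ := exists_lift_point j (z ω) hω
    obtain ⟨ψ, rfl⟩ := exists_pointOf_eq q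
    exact ⟨ψ, hq.symm⟩
  obtain ⟨ω₀, hω₀⟩ := U.nonempty_of_mem hi
  obtain ⟨ψ₀, -⟩ := hlift ω₀ hω₀
  classical
  refine ⟨𝒱.X i, inferInstance, inferInstance, ?_, j, hj,
    fun ω => if h : pt (z ω) ∈ Set.range (𝒱.f i) then (hlift ω h).choose else ψ₀, ?_⟩
  · rw [HasRingHomProperty.Spec_iff (P := @LocallyOfFiniteType)] at hft
    exact hft
  · filter_upwards [hi] with ω hω
    rw [dif_pos hω]
    exact (hlift ω hω).choose_spec

variable {A C : Type u} [CommRing A] [Algebra k A] [CommRing C] [Algebra k C]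

/-- If a family of `k`-points of `Spec A` is mapped by `f : Spec A ⟶ X` into an open chart
`j : Spec C ⟶ X` almost everywhere, it lifts almost everywhere to a basic open subset `Spec E` of
`Spec A` on which `f` factors through the chart. -/
theorem exists_localization_factor {X : Over (Spec (.of k))} [Algebra.FiniteType k A]
    {Ω : Type*} (U : Ultrafilter Ω) (ψ : Ω → A →ₐ[k] k) (f : specOver k A ⟶ X)
    (j : specOver k C ⟶ X) [IsOpenImmersion j.left]
    (h : ∀ᶠ ω in U, pt (pointOf (ψ ω) ≫ f) ∈ Set.range j.left) :
    ∃ (E : Type u) (_ : CommRing E) (_ : Algebra k E) (_ : Algebra.FiniteType k E)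
      (ℓ : A →ₐ[k] E) (m : C →ₐ[k] E) (ζ : Ω → E →ₐ[k] k),
      specOverMap ℓ ≫ f = specOverMap m ≫ j ∧ ∀ᶠ ω in U, (ζ ω).comp ℓ = ψ ω := by
  have : IsNoetherianRing A := Algebra.FiniteType.isNoetherianRing k A
  let O : Set (PrimeSpectrum A) := f.left ⁻¹' Set.range j.left
  have hO : IsOpen O := j.left.isOpenEmbedding.isOpen_range.preimage f.left.continuous
  obtain ⟨t, ht⟩ := PrimeSpectrum.isCompact_isOpen_iff.1
    ⟨TopologicalSpace.NoetherianSpace.isCompact O, hO⟩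
  have hmemO : ∀ x : PrimeSpectrum A, x ∈ O ↔
      ∃ a ∈ t, x ∈ (PrimeSpectrum.basicOpen a : Set (PrimeSpectrum A)) := by
    intro x
    rw [← ht]
    simp [PrimeSpectrum.mem_zeroLocus, Set.not_subset]
  have hU : (⋃ a ∈ (t : Set A), {ω | ψ ω a ≠ 0}) ∈ U := by
    filter_upwards [h] with ω hω
    rw [pt_comp] at hω
    obtain ⟨a, ha, hωa⟩ := (hmemO (pt (pointOf (ψ ω)))).1 hω
    exact Set.mem_biUnion ha ((pt_pointOf_mem_basicOpen (ψ ω) a).1 hωa)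
  obtain ⟨a, hat, ha⟩ := (Ultrafilter.finite_biUnion_mem_iff t.finite_toSet).1 hU
  let E := Localization.Away a
  let ℓ : A →ₐ[k] E := IsScalarTower.toAlgHom k A E
  have hlift : ∀ ω, ψ ω a ≠ 0 → ∃ ζ : E →ₐ[k] k, ζ.comp ℓ = ψ ω := fun ω hω =>
    ⟨IsLocalization.liftAlgHom (M := Submonoid.powers a) (f := ψ ω) (by
      rintro ⟨_, n, rfl⟩
      simpa using (IsUnit.mk0 _ hω).pow n), by
      ext x
      simp [ℓ]⟩
  obtain ⟨ω₀, hω₀⟩ := U.nonempty_of_mem ha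
  obtain ⟨ζ₀, -⟩ := hlift ω₀ hω₀
  have hrange : Set.range (specOverMap ℓ ≫ f).left ⊆ Set.range j.left := by
    rintro _ ⟨x, rfl⟩
    have hx : (specOverMap ℓ).left x ∈ (PrimeSpectrum.basicOpen a : Set (PrimeSpectrum A)) := by
      rw [← PrimeSpectrum.localization_away_comap_range E a]
      exact ⟨x, rfl⟩
    exact (hmemO _).2 ⟨a, hat, hx⟩
  obtain ⟨m', hm'⟩ := exists_lift j _ hrange
  obtain ⟨m, rfl⟩ := exists_specOverMap_eq m'
  classical
  refine ⟨E, inferInstance, inferInstance, ?_, ℓ, m,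
    fun ω => if h : ψ ω a ≠ 0 then (hlift ω h).choose else ζ₀, hm'.symm, ?_⟩
  · have : Algebra.FiniteType A E := IsLocalization.finiteType_of_monoid_fg (Submonoid.powers a) E
    exact Algebra.FiniteType.trans (S := A) inferInstance this
  · filter_upwards [ha] with ω hω
    rw [dif_pos hω]
    exact (hlift ω hω).choose_spec

end Charts

/-! ### Saturation of varieties over an uncountable field -/

section Saturation

variable {k : Type u} [Field k] {Ω : Type*}

/-- A specialization for which a certain finite set of functions is defined respects the truth
value, along the ultrafilter `U`, of the relation `f p = g q` between `k`-points of `Spec A` and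
of `Spec B`. The finite set contains functions generating the coordinate rings of the charts that
occur, which yields all equations, and one inverse function, if needed, to preserve an
inequation. -/
theorem exists_finite_map_comp_eq_iff {X : Over (Spec (.of k))} [LocallyOfFiniteType X.hom]
    [CompactSpace X.left] {A B : Type u} [CommRing A] [Algebra k A] [Algebra.FiniteType k A]
    [CommRing B] [Algebra k B] [Algebra.FiniteType k B] (U : Ultrafilter Ω)
    (f : specOver k A ⟶ X) (g : specOver k B ⟶ X) (ψ : Ω → A →ₐ[k] k) (χ : Ω → B →ₐ[k] k) :
    ∃ T : Set (Ω → k), T.Finite ∧ ∀ (s : Specialization k (U : Filter Ω))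
      (hψ : ∀ a, evalFun ψ a ∈ s.ring) (hχ : ∀ b, evalFun χ b ∈ s.ring), T ⊆ s.ring →
      (pointOf (s.map ψ hψ) ≫ f = pointOf (s.map χ hχ) ≫ g ↔
        ∀ᶠ ω in U, pointOf (ψ ω) ≫ f = pointOf (χ ω) ≫ g) := by
  obtain ⟨C, _, _, hC, j, hj, θ, hθ⟩ := exists_chart U fun ω => pointOf (ψ ω) ≫ f
  have hmono : Mono j := by
    have : Mono ((Over.forget _).map j) := inferInstanceAs (Mono j.left)
    exact (Over.forget _).mono_of_mono_map this
  have hfmem : ∀ᶠ ω in U, pt (pointOf (ψ ω) ≫ f) ∈ Set.range j.left :=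
    hθ.mono fun ω hω => by rw [hω, pt_comp]; exact ⟨_, rfl⟩
  obtain ⟨E₁, _, _, _, ℓ₁, m₁, ζ₁, hfac₁, hζ₁⟩ := exists_localization_factor U ψ f j hfmem
  obtain ⟨T₁, hT₁, hT₁'⟩ := exists_finite_forall_evalFun_mem ζ₁
  -- The specialization of `ψ` is the image of the specialization of its lift `ζ₁`.
  have hf : ∀ (s : Specialization k (U : Filter Ω)) (hψ : ∀ a, evalFun ψ a ∈ s.ring)
      (h₁ : T₁ ⊆ s.ring), pointOf (s.map ψ hψ) ≫ f =
        pointOf ((s.map ζ₁ (hT₁' s.ring h₁)).comp m₁) ≫ j := by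
    intro s hψ h₁
    have h := s.map_comp_eq (hT₁' s.ring h₁) hψ ℓ₁ (AlgHom.id k A) hζ₁
    rw [AlgHom.comp_id] at h
    rw [← h, pointOf_comp, pointOf_comp, Category.assoc, Category.assoc, hfac₁]
  by_cases hgmem : ∀ᶠ ω in U, pt (pointOf (χ ω) ≫ g) ∈ Set.range j.left
  · obtain ⟨E₂, _, _, _, ℓ₂, m₂, ζ₂, hfac₂, hζ₂⟩ := exists_localization_factor U χ g j hgmem
    obtain ⟨T₂, hT₂, hT₂'⟩ := exists_finite_forall_evalFun_mem ζ₂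
    have hg : ∀ (s : Specialization k (U : Filter Ω)) (hχ : ∀ a, evalFun χ a ∈ s.ring)
        (h₂ : T₂ ⊆ s.ring), pointOf (s.map χ hχ) ≫ g =
          pointOf ((s.map ζ₂ (hT₂' s.ring h₂)).comp m₂) ≫ j := by
      intro s hχ h₂
      have h := s.map_comp_eq (hT₂' s.ring h₂) hχ ℓ₂ (AlgHom.id k B) hζ₂
      rw [AlgHom.comp_id] at h
      rw [← h, pointOf_comp, pointOf_comp, Category.assoc, Category.assoc, hfac₂]
    have hiff : ∀ᶠ ω in U, (pointOf (ψ ω) ≫ f = pointOf (χ ω) ≫ g ↔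
        (ζ₁ ω).comp m₁ = (ζ₂ ω).comp m₂) := by
      filter_upwards [hζ₁, hζ₂] with ω h₁ h₂
      rw [← h₁, ← h₂, pointOf_comp, pointOf_comp, Category.assoc, Category.assoc, hfac₁, hfac₂,
        ← Category.assoc, ← Category.assoc, ← pointOf_comp, ← pointOf_comp, cancel_mono]
      exact pointOf_injective.eq_iff
    by_cases heq : ∀ᶠ ω in U, pointOf (ψ ω) ≫ f = pointOf (χ ω) ≫ g
    · refine ⟨T₁ ∪ T₂, hT₁.union hT₂, fun s hψ hχ hT => ?_⟩
      obtain ⟨h₁, h₂⟩ := Set.union_subset_iff.1 hT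
      simp only [heq, iff_true]
      rw [hf s hψ h₁, hg s hχ h₂,
        s.map_comp_eq (hT₁' _ h₁) (hT₂' _ h₂) m₁ m₂ ((heq.and hiff).mono fun ω h => h.2.1 h.1)]
    · obtain ⟨t, ht⟩ := (Algebra.FiniteType.out : (⊤ : Subalgebra k C).FG)
      -- One of the finitely many generators of `C` separates the two points almost everywhere.
      have hU : (⋃ c ∈ (t : Set C), {ω | ζ₁ ω (m₁ c) ≠ ζ₂ ω (m₂ c)}) ∈ U := by
        filter_upwards [Ultrafilter.eventually_not.2 heq, hiff] with ω h h'
        rw [h'] at h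
        by_contra hcon
        refine h (AlgHom.ext_of_adjoin_eq_top ht fun c hc => ?_)
        by_contra hne
        exact hcon (Set.mem_biUnion hc hne)
      obtain ⟨c, -, hc⟩ := (Ultrafilter.finite_biUnion_mem_iff t.finite_toSet).1 hU
      refine ⟨insert (evalFun ζ₁ (m₁ c) - evalFun ζ₂ (m₂ c))⁻¹ (T₁ ∪ T₂),
        (hT₁.union hT₂).insert _, fun s hψ hχ hT => ?_⟩
      obtain ⟨h₀, hT⟩ := Set.insert_subset_iff.1 hT
      obtain ⟨h₁, h₂⟩ := Set.union_subset_iff.1 hT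
      simp only [heq, iff_false]
      rw [hf s hψ h₁, hg s hχ h₂, cancel_mono, pointOf_injective.eq_iff]
      intro hcon
      have hne := s.hom_ne_zero
        (⟨_, hT₁' s.ring h₁ (m₁ c)⟩ - ⟨_, hT₂' s.ring h₂ (m₂ c)⟩)
        (Filter.mem_of_superset hc fun ω hω => (sub_ne_zero (b := ζ₂ ω (m₂ c))).2 hω) h₀
      rw [map_sub, sub_ne_zero] at hne
      exact hne (DFunLike.congr_fun hcon c)
  · -- Almost all `g (χ ω)` lie outside the chart, and then so does the specialization.
    have hne : ¬ ∀ᶠ ω in U, pointOf (ψ ω) ≫ f = pointOf (χ ω) ≫ g := fun h =>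
      hgmem ((h.and hfmem).mono fun ω hω => hω.1 ▸ hω.2)
    refine ⟨T₁, hT₁, fun s hψ hχ h₁ => ?_⟩
    simp only [hne, iff_false]
    intro hcon
    have hmem : pt (pointOf (s.map χ hχ) ≫ g) ∈ Set.range j.left := by
      rw [← hcon, hf s hψ h₁, pt_comp]; exact ⟨_, rfl⟩
    let O : Set (PrimeSpectrum B) := g.left ⁻¹' Set.range j.left
    have hO : IsOpen O := j.left.isOpenEmbedding.isOpen_range.preimage g.left.continuous
    rw [pt_comp] at hmem
    obtain ⟨_, ⟨b, rfl⟩, hb, hbO⟩ :=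
      PrimeSpectrum.isTopologicalBasis_basic_opens.exists_subset_of_mem_open
        (show (pt (pointOf (s.map χ hχ)) : PrimeSpectrum B) ∈ O from hmem) hO
    refine (pt_pointOf_mem_basicOpen _ b).1 hb ?_
    rw [s.map_apply, ← map_zero s.hom]
    refine s.hom_congr _ _ ?_
    filter_upwards [Ultrafilter.eventually_not.2 hgmem] with ω hω
    by_contra hbω
    refine hω ?_
    rw [pt_comp]
    exact hbO ((pt_pointOf_mem_basicOpen (χ ω) b).2 hbω)

/-- A relation `f (z left) = g (z right)` between two members of a family of `k`-points `z i` of the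
schemes `Z i`, with values in a scheme of finite type over `k`. -/
structure PointRelation {I : Type*} (Z : I → Over (Spec (.of k))) where
  /-- The scheme in which the points are compared. -/
  target : Over (Spec (.of k))
  /-- The target is locally of finite type. -/
  locallyOfFiniteType : LocallyOfFiniteType target.hom
  /-- The target is quasi-compact. -/
  compactSpace : CompactSpace target.left
  /-- The index of the point on the left-hand side. -/
  left : I
  /-- The index of the point on the right-hand side. -/
  right : I
  /-- The morphism applied on the left-hand side. -/
  f : Z left ⟶ target
  /-- The morphism applied on the right-hand side. -/
  g : Z right ⟶ target

/-- The family of `k`-points `z` satisfies the relation `c`. -/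
def PointRelation.Holds {I : Type*} {Z : I → Over (Spec (.of k))} (c : PointRelation Z)
    (z : ∀ i, KPoints (Z i)) : Prop :=
  z c.left ≫ c.f = z c.right ≫ c.g

/-- Countable saturation: let `z i` be countably many families of `k`-points, indexed by `Ω`, of
schemes of finite type over the uncountable algebraically closed field `k`. For countably many
relations between them there are `k`-points satisfying exactly those relations that hold along the
ultrafilter `U`. -/
theorem exists_points_forall_holds_iff [IsAlgClosed k] [Uncountable k] (U : Ultrafilter Ω)
    {I : Type*} [Countable I] (Z : I → Over (Spec (.of k)))
    [∀ i, LocallyOfFiniteType (Z i).hom] [∀ i, CompactSpace (Z i).left]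
    (z : Ω → ∀ i, KPoints (Z i)) {J : Type*} [Countable J] (c : J → PointRelation Z) :
    ∃ z' : ∀ i, KPoints (Z i), ∀ r, (c r).Holds z' ↔ ∀ᶠ ω in U, (c r).Holds (z ω) := by
  have := fun r => (c r).locallyOfFiniteType
  have := fun r => (c r).compactSpace
  choose A _ _ _ j _ ψ hψ using fun i => exists_chart U fun ω => z ω i
  choose T hT hT' using fun i => exists_finite_forall_evalFun_mem (ψ i)
  choose T₂ hT₂ hT₂' using fun r =>
    exists_finite_map_comp_eq_iff U (j (c r).left ≫ (c r).f) (j (c r).right ≫ (c r).g)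
      (ψ (c r).left) (ψ (c r).right)
  obtain ⟨s, hs⟩ := exists_specialization (k := k) (U : Filter Ω)
    (T := (⋃ i, T i) ∪ ⋃ r, T₂ r)
    ((Set.countable_iUnion fun i => (hT i).countable).union
      (Set.countable_iUnion fun r => (hT₂ r).countable))
  obtain ⟨hs₁, hs₂⟩ := Set.union_subset_iff.1 hs
  have hmem : ∀ i e, evalFun (ψ i) e ∈ s.ring := fun i =>
    hT' i s.ring ((Set.subset_iUnion T i).trans hs₁)
  refine ⟨fun i => pointOf (s.map (ψ i) (hmem i)) ≫ j i, fun r => ?_⟩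
  simp only [PointRelation.Holds]
  rw [Category.assoc, Category.assoc,
    hT₂' r s (hmem _) (hmem _) ((Set.subset_iUnion T₂ r).trans hs₂)]
  refine Filter.eventually_congr ?_
  filter_upwards [hψ (c r).left, hψ (c r).right] with ω h₁ h₂
  rw [h₁, h₂, Category.assoc, Category.assoc]

end Saturation

/-! ### Subvarieties of powers are of finite type -/

section FiniteType

variable {k : Type u} [Field k]

theorem locallyOfFiniteType_and_quasiCompact_power (X : Over (Spec (.of k)))
    [LocallyOfFiniteType X.hom] [QuasiCompact X.hom] (E : Type v) [Finite E] :
    LocallyOfFiniteType (power X E).hom ∧ QuasiCompact (power X E).hom := by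
  let Q : ObjectProperty (Over (Spec (.of k))) :=
    fun Z => LocallyOfFiniteType Z.hom ∧ QuasiCompact Z.hom
  have : Q.IsClosedUnderIsomorphisms := ⟨fun {Z W} e h => by
    have hlft : LocallyOfFiniteType Z.hom := h.1
    have hqc : QuasiCompact Z.hom := h.2
    have hiso : IsIso e.inv.left := inferInstanceAs (IsIso ((Over.forget _).map e.inv))
    have hW : W.hom = e.inv.left ≫ Z.hom := (Over.w e.inv).symm
    exact ⟨hW ▸ locallyOfFiniteType_comp e.inv.left Z.hom,
      hW ▸ quasiCompact_comp e.inv.left Z.hom⟩⟩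
  have : Q.IsClosedUnderBinaryProducts := .mk' (by
    rintro _ ⟨F, hF⟩
    let Z₁ := F.obj ⟨.left⟩
    let Z₂ := F.obj ⟨.right⟩
    refine Q.prop_of_iso (HasLimit.isoOfNatIso (diagramIsoPair F)).symm ?_
    have hh : (Z₁ ⨯ Z₂).hom = (Over.prodLeftIsoPullback Z₁ Z₂).hom ≫
        pullback.fst Z₁.hom Z₂.hom ≫ Z₁.hom := by
      rw [← Category.assoc, Over.prodLeftIsoPullback_hom_fst, Over.w]
    obtain ⟨h₁, h₁'⟩ : LocallyOfFiniteType Z₁.hom ∧ QuasiCompact Z₁.hom := hF ⟨.left⟩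
    obtain ⟨h₂, h₂'⟩ : LocallyOfFiniteType Z₂.hom ∧ QuasiCompact Z₂.hom := hF ⟨.right⟩
    change LocallyOfFiniteType (Z₁ ⨯ Z₂).hom ∧ QuasiCompact (Z₁ ⨯ Z₂).hom
    rw [hh]
    exact ⟨inferInstance, inferInstance⟩)
  have : Q.IsClosedUnderLimitsOfShape (Discrete.{0} PEmpty) := ⟨fun W hW => by
    obtain ⟨t⟩ := (ObjectProperty.limitsOfShape_isEmpty_iff _ _ _).1 hW
    exact Q.prop_of_iso (Over.mkIdTerminal.uniqueUpToIso t)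
      ⟨inferInstanceAs (LocallyOfFiniteType (𝟙 _)), inferInstanceAs (QuasiCompact (𝟙 _))⟩⟩
  have : Q.IsClosedUnderFiniteProducts := .mk'
  exact ObjectProperty.prop_pi Q _ fun _ => ⟨inferInstance, inferInstance⟩

theorem Presents.locallyOfFiniteType {X V : Over (Spec (.of k))} [LocallyOfFiniteType X.hom]
    [QuasiCompact X.hom] {E : Type v} [Finite E] {S : Set (E → KPoints X)} {i : V ⟶ power X E}
    (h : Presents S i) : LocallyOfFiniteType V.hom := by
  have := h.immersion
  have := (locallyOfFiniteType_and_quasiCompact_power X E).1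
  rw [← Over.w i]
  infer_instance

theorem Presents.compactSpace {X V : Over (Spec (.of k))} [LocallyOfFiniteType X.hom]
    [QuasiCompact X.hom] {E : Type v} [Finite E] {S : Set (E → KPoints X)} {i : V ⟶ power X E}
    (h : Presents S i) : CompactSpace V.left := by
  have := h.immersion
  obtain ⟨_, _⟩ := locallyOfFiniteType_and_quasiCompact_power X E
  have : IsLocallyNoetherian (power X E).left :=
    LocallyOfFiniteType.isLocallyNoetherian (power X E).hom
  have : CompactSpace (power X E).left := QuasiCompact.compactSpace_of_compactSpace (power X E).hom
  have : IsNoetherian (power X E).left := {}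
  have := (i.left.isEmbedding.isInducing).noetherianSpace
  infer_instance

end FiniteType

/-! ### Inverses of injective algebraic cellular automata -/

/-- An injective algebraic cellular automaton on a prodiscretely closed algebraic subshift has an
inverse with finite memory. Otherwise, for every finite `N` there are configurations which differ at
the identity and whose images agree on `N`. The points of the varieties `S_E` and of the domain of
the local rule given by such pairs satisfy countably many relations, and by saturation one pair
satisfies them for all `N` at once, contradicting injectivity. -/
theorem exists_memory_of_injective {G : Type v} [Monoid G] [Countable G] {k : Type u} [Field k]
    [IsAlgClosed k] [Uncountable k] {X Y : Over (Spec (.of k))} [IsVariety X] [IsVariety Y]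
    {S : Set (G → KPoints X)} (hS : IsAlgebraicSubshift S) (hclosed : IsProdiscreteClosed S)
    {τ : S → G → KPoints Y} (hτ : IsAlgebraicCA hS τ) (hinj : Function.Injective τ) :
    ∃ N : Finset G, ∀ x y : S, (∀ n ∈ N, τ x n = τ y n) → x.1 1 = y.1 1 := by
  classical
  by_contra! hcon
  have := IsVariety.locallyOfFiniteType (X := X)
  have := IsVariety.locallyOfFiniteType (X := Y)
  have := IsVariety.quasiCompact (X := X)
  have := IsVariety.quasiCompact (X := Y)
  have hXc : CompactSpace X.left := QuasiCompact.compactSpace_of_compactSpace X.hom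
  have hYc : CompactSpace Y.left := QuasiCompact.compactSpace_of_compactSpace Y.hom
  obtain ⟨M, μ, ⟨V', i', f, hV', hf⟩, hμ⟩ := hτ
  choose V i hV using hS.2
  -- Lift the patterns of a configuration to points of the varieties presenting the pattern sets.
  have hP : ∀ (c : S) (E : Finset G), ∃ p : KPoints (V E), coords (p ≫ i E) = E.restrict c.1 := by
    intro c E
    have h : E.restrict c.1 ∈ restrictSet S E := ⟨c.1, c.2, rfl⟩
    rwa [← (hV E).range_eq] at h
  have hR : ∀ (c : S) (h : G), ∃ p : KPoints V',
      coords (p ≫ i') = M.restrict (shift h c.1) := by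
    intro c h
    have h := shift_restrict_mem hS.1 M c h
    rwa [← hV'.range_eq] at h
  choose P hP using hP
  choose R hR using hR
  have hτf : ∀ (c : S) (h : G) (p : KPoints V'), coords (p ≫ i') = M.restrict (shift h c.1) →
      τ c h = p ≫ f := fun c h p hp => by rw [hμ c h, hf p _ hp]
  -- An ultrafilter of pairs that differ at the identity and whose images agree on every finite set.
  let F : Finset G → Set (S × S) :=
    fun N => {ω | (∀ n ∈ N, τ ω.1 n = τ ω.2 n) ∧ ω.1.1 1 ≠ ω.2.1 1}
  obtain ⟨x₀, y₀, -⟩ := hcon ∅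
  have : Nonempty (S × S) := ⟨(x₀, y₀)⟩
  have hne : (⨅ N, Filter.principal (F N)).NeBot := by
    refine Filter.iInf_neBot_of_directed (fun N₁ N₂ => ⟨N₁ ∪ N₂, ?_, ?_⟩) fun N => ?_
    · exact Filter.principal_mono.2 fun ω hω =>
        ⟨fun n hn => hω.1 n (Finset.mem_union_left _ hn), hω.2⟩
    · exact Filter.principal_mono.2 fun ω hω =>
        ⟨fun n hn => hω.1 n (Finset.mem_union_right _ hn), hω.2⟩
    · obtain ⟨x, y, h, h1⟩ := hcon N
      exact Filter.principal_neBot_iff.2 ⟨(x, y), h, h1⟩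
  let U : Ultrafilter (S × S) := Ultrafilter.of (⨅ N, Filter.principal (F N))
  have hU : ∀ N, F N ∈ U := fun N => (Ultrafilter.of_le _).trans (iInf_le _ N)
    (Filter.mem_principal_self _)
  -- The unknowns: the letters of the two configurations, their patterns, and the arguments of the
  -- local rule.
  let Z : Bool × (G ⊕ Finset G ⊕ G) → Over (Spec (.of k)) :=
    fun a => Sum.elim (fun _ => X) (Sum.elim V fun _ => V') a.2
  have : ∀ a, LocallyOfFiniteType (Z a).hom := by
    rintro ⟨_, _ | E | _⟩
    exacts [IsVariety.locallyOfFiniteType (X := X), (hV E).locallyOfFiniteType, hV'.locallyOfFiniteType]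
  have : ∀ a, CompactSpace (Z a).left := by
    rintro ⟨_, _ | E | _⟩
    exacts [hXc, (hV E).compactSpace, hV'.compactSpace]
  let conf : S × S → Bool → S := fun ω b => bif b then ω.1 else ω.2
  let z : S × S → ∀ a, KPoints (Z a) := fun ω a => match a with
    | (b, .inl g) => (conf ω b).1 g
    | (b, .inr (.inl E)) => P (conf ω b) E
    | (b, .inr (.inr h)) => R (conf ω b) h
  let c : (Bool × Σ E : Finset G, E) ⊕ (Bool × G × M) ⊕ G ⊕ Unit → PointRelation Z :=
    Sum.elim (fun q => ⟨X, inferInstance, inferInstance, (q.1, .inr (.inl q.2.1)),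
        (q.1, .inl q.2.2.1), i q.2.1 ≫ Pi.π (fun _ => X) q.2.2, 𝟙 X⟩) <|
    Sum.elim (fun q => ⟨X, inferInstance, inferInstance, (q.1, .inr (.inr q.2.1)),
        (q.1, .inl (q.2.2.1 * q.2.1)), i' ≫ Pi.π (fun _ => X) q.2.2, 𝟙 X⟩) <|
    Sum.elim (fun h => ⟨Y, inferInstance, inferInstance, (true, .inr (.inr h)),
        (false, .inr (.inr h)), f, f⟩) <|
    fun _ => ⟨X, inferInstance, inferInstance, (true, .inl 1), (false, .inl 1), 𝟙 X, 𝟙 X⟩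
  obtain ⟨z', hz'⟩ := exists_points_forall_holds_iff U Z z c
  let x : Bool → G → KPoints X := fun b g => z' (b, .inl g)
  have hx : ∀ b, x b ∈ S := by
    intro b
    refine hclosed.mem_of_forall_restrict fun E => ?_
    rw [← (hV E).range_eq]
    refine ⟨z' (b, .inr (.inl E)), funext fun e => ?_⟩
    have h := (hz' (.inl (b, ⟨E, e⟩))).2 (Filter.Eventually.of_forall fun ω => by
      have := congrFun (hP (conf ω b) E) e
      simp only [coords, Category.assoc] at this
      exact this.trans (Category.comp_id _).symm)
    simp only [coords]
    exact h.trans (Category.comp_id _)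
  have hr : ∀ b h, τ ⟨x b, hx b⟩ h = z' (b, .inr (.inr h)) ≫ f := by
    intro b h
    refine hτf _ h _ (funext fun m => ?_)
    have h := (hz' (.inr (.inl (b, h, m)))).2 (Filter.Eventually.of_forall fun ω => by
      have := congrFun (hR (conf ω b) h) m
      simp only [coords, Category.assoc] at this
      exact this.trans (Category.comp_id _).symm)
    simp only [coords]
    exact h.trans (Category.comp_id _)
  have heq : τ ⟨x true, hx true⟩ = τ ⟨x false, hx false⟩ := by
    funext h
    rw [hr, hr]
    refine (hz' (.inr (.inr (.inl h)))).2 (Filter.mem_of_superset (hU {h}) fun ω hω => ?_)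
    have := hω.1 h (Finset.mem_singleton_self h)
    rw [hτf _ h _ (hR ω.1 h), hτf _ h _ (hR ω.2 h)] at this
    exact this
  have h1 : x true 1 = x false 1 := congrFun (congrArg Subtype.val (hinj heq)) 1
  have h2 := (hz' (.inr (.inr (.inr ())))).1 (by
    change x true 1 ≫ 𝟙 X = x false 1 ≫ 𝟙 X
    rw [h1])
  obtain ⟨ω, hω, hω'⟩ := (h2.and (hU ∅)).exists
  refine hω'.2 ?_
  have hω : ω.1.1 1 ≫ 𝟙 X = ω.2.1 1 ≫ 𝟙 X := hω
  rwa [Category.comp_id, Category.comp_id] at hω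

end SymbolicVariety

theorem theoremA {G : Type v} [Monoid G] [Countable G]
    {k : Type u} [Field k] [IsAlgClosed k] [Uncountable k]
    (X Y : Over (Spec (.of k))) [SymbolicVariety.IsVariety X] [SymbolicVariety.IsVariety Y]
    (S : Set (G → SymbolicVariety.KPoints X))
    (hS : SymbolicVariety.IsAlgebraicSubshift S)
    (hclosed : SymbolicVariety.IsProdiscreteClosed S)
    (τ : S → G → SymbolicVariety.KPoints Y)
    (hτ : SymbolicVariety.IsAlgebraicCA hS τ)
    (hinj : Function.Injective τ)
    (Δ : Set (G → SymbolicVariety.KPoints X))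
    (hΔ : SymbolicVariety.IsSubshift Δ) (hΔS : Δ ⊆ S) :
    (SymbolicVariety.IsSFT Δ ↔
      SymbolicVariety.IsSFT (τ '' {x : S | x.1 ∈ Δ})) ∧
    (SymbolicVariety.IsSofic Δ ↔
      SymbolicVariety.IsSofic (τ '' {x : S | x.1 ∈ Δ})) := by
  obtain ⟨N, hN⟩ := SymbolicVariety.exists_memory_of_injective hS hclosed hτ hinj
  obtain ⟨M, μ, -, hμ⟩ := hτ
  exact SymbolicVariety.isSFT_and_isSofic_image_iff hS.1 hμ hN hΔS
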